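/- For a monoid $M$, a subset $A\subseteq M$ and a symbol $\#\notin A$, let $$\mathrm{WP}(M,A)=\{\,u\,\#\,v^{\mathrm{rev}} : u,v\in A^{*},\ u \text{ and } v \text{ represent the same element of } M\,\},$$ where $v^{\mathrm{rev}}$ is the reverse of the word $v$. A monoid $M$ is a $U(\mathrm{CF})$ monoid if it has a finite generating set $A$ for which $\mathrm{WP}(M,A)$ is a context-free language. Theorem. The class of $U(\mathrm{CF})$ monoids is closed under taking monoid free products and free factors. That is: (1) if $M$ and $N$ are $U(\mathrm{CF})$ monoids, then their monoid free product $M * N$ (the coproduct in the category of monoids) is a $U(\mathrm{CF})$ monoid; (2) if a monoid $P$ is a $U(\mathrm{CF})$ monoid and $M$ is a free factor of $P$, i.e. $P\cong M * N$ for some monoid $N$, then $M$ is a $U(\mathrm{CF})$ monoid. -/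

import Mathlib

universe u v w

/-- The word problem of a monoid `M` with respect to a set `A` of elements of `M`: the language
of all words `u # v^rev`, where `u, v` are (possibly empty) words over `A` that represent the same
element of `M`. The alphabet `A ∪ {#}` is `Option A`: a letter `a` is `some a`, and `#` is
`none`. -/
def monoidWordProblem {M : Type*} [Monoid M] (A : Set M) : Language (Option A) :=
  {w | ∃ u v : List A,
    (u.map Subtype.val).prod = (v.map Subtype.val).prod ∧
      w = u.map some ++ none :: v.reverse.map some}

/-- `M` is a `U(CF)` monoid: with respect to some finite generating set, its word problem is a
context-free language. -/
def HasContextFreeWordProblem (M : Type*) [Monoid M] : Prop :=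
  ∃ A : Set M, A.Finite ∧ Submonoid.closure A = ⊤ ∧ (monoidWordProblem A).IsContextFree

/-- `M` is a free factor of `P`, with a complementary factor in `Type w`: up to isomorphism, `P` is
the monoid free product of `M` and some monoid `N`. -/
def IsMonoidFreeFactor (M : Type u) (P : Type v) [Monoid M] [Monoid P] : Prop :=
  ∃ (N : Type w) (_ : Monoid N), Nonempty (P ≃* Monoid.Coprod M N)

/-!
A word problem `WP(M, A)` is treated as a language of words `u # v^rev`, and everything rests on
two closure properties of context-free languages. One is closure under finite-state transductions
(`Language.IsContextFree.transduce`), by the triple construction. The other is nested iterated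
substitution (`Language.isContextFree_of_schemes`): a system of context-free rules stays
context-free when the right-hand sides of the rules range over context-free languages.

*Free factors.* A finitely generated submonoid `M` of a `U(CF)` monoid `P` is `U(CF)`
(`HasContextFreeWordProblem.of_injective`). Writing each generator of `M` as a nonempty word over
the generators of `P`, and the reversed word to the right of `#`, presents the word problem of `M`
as an inverse image of that of `P`, which a transducer computes. A free factor of `P` embeds in `P`
and is a quotient of `P`, hence is finitely generated.

*Free products.* By uniqueness of normal forms, every word over the generators of a free product
has the form `e U₁ U₂ ⋯ Uₖ`, where `e` represents the identity, the normal form of the element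
represented is `x₁ x₂ ⋯ xₖ`, and each `Uⱼ` is a word over the generators of one factor that
represents `xⱼ`, with words representing the identity inserted after its letters
(`exists_mem_syllableWords`). Hence the words that represent the identity are exactly those derived
from the rules `I → a₁ I a₂ I ⋯ aₙ I`, where `a₁ ⋯ aₙ` represents the identity of a factor, and the
word problem is derived from the rules `W → #`, `W → I W I'` and
`W → a₁ I ⋯ aₘ I W I' bₙ ⋯ I' b₁`, where `a₁ ⋯ aₘ` and `b₁ ⋯ bₙ` represent the same element of a
factor and `I'` derives the reversals of the words derived from `I`. The right-hand sides of these
rules are transductions of the word problems of the factors, so both systems are instances of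
nested iterated substitution. The separate nonterminal `I'` is needed because the reversal of a word
that represents the identity need not represent the identity.
-/

/-! ### Derivations from a set of context-free rules -/

/-- Big-step derivations: `Yields R α w` says that the sentential form `α` can be rewritten to the
terminal word `w` by the context-free rules `X → β`, `(X, β) ∈ R`. The rule set `R` may be
infinite, and the nonterminals may live in any universe. -/
inductive Yields {T N : Type*} (R : Set (N × List (Symbol T N))) :
    List (Symbol T N) → List T → Prop
  | nil : Yields R [] []
  | terminal {t : T} {α : List (Symbol T N)} {w : List T} :
      Yields R α w → Yields R (.terminal t :: α) (t :: w)
  | nonterminal {X : N} {β α : List (Symbol T N)} {u w : List T} :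
      (X, β) ∈ R → Yields R β u → Yields R α w → Yields R (.nonterminal X :: α) (u ++ w)

namespace Yields

variable {T N : Type*} {R : Set (N × List (Symbol T N))} {α β : List (Symbol T N)} {u w : List T}

theorem append (hα : Yields R α u) (hβ : Yields R β w) : Yields R (α ++ β) (u ++ w) := by
  induction hα with
  | nil => exact hβ
  | terminal _ ih => exact .terminal ih
  | nonterminal hX hu _ _ ih => simpa using Yields.nonterminal hX hu ih

theorem append_iff : Yields R (α ++ β) w ↔ ∃ u v, w = u ++ v ∧ Yields R α u ∧ Yields R β v := by
  refine ⟨fun h ↦ ?_, fun ⟨u, v, hw, hu, hv⟩ ↦ hw ▸ hu.append hv⟩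
  induction α generalizing w with
  | nil => exact ⟨[], w, rfl, .nil, h⟩
  | cons s α ih =>
    cases h with
    | terminal h =>
      obtain ⟨u, v, rfl, hu, hv⟩ := ih h
      exact ⟨_, v, rfl, .terminal hu, hv⟩
    | nonterminal hX hx h =>
      obtain ⟨u, v, rfl, hu, hv⟩ := ih h
      exact ⟨_, v, (List.append_assoc ..).symm, .nonterminal hX hx hu, hv⟩

theorem of_rule {X : N} (hX : (X, β) ∈ R) (h : Yields R β w) :
    Yields R [.nonterminal X] w := by
  simpa using Yields.nonterminal hX h .nil

theorem singleton_iff {X : N} :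
    Yields R [.nonterminal X] w ↔ ∃ β, (X, β) ∈ R ∧ Yields R β w := by
  refine ⟨fun h ↦ ?_, fun ⟨β, hX, h⟩ ↦ .of_rule hX h⟩
  cases h with
  | nonterminal hX hu h =>
    cases h
    exact ⟨_, hX, by simpa using hu⟩

variable (R) in
theorem map_terminal (w : List T) : Yields R (w.map .terminal) w := by
  induction w with
  | nil => exact .nil
  | cons t w ih => exact .terminal ih

theorem map_terminal_iff : Yields R (u.map .terminal) w ↔ w = u := by
  refine ⟨fun h ↦ ?_, fun h ↦ h ▸ map_terminal R w⟩
  induction u generalizing w with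
  | nil => cases h; rfl
  | cons t u ih =>
    cases h with
    | terminal h => rw [ih h]

/-- The product of languages denoted by a sentential form when every nonterminal `X` denotes the
language `S X`. -/
def denotation (S : N → Language T) (α : List (Symbol T N)) : Language T :=
  (α.map fun
    | .terminal t => {[t]}
    | .nonterminal X => S X).prod

@[simp] theorem denotation_nil (S : N → Language T) : denotation S [] = 1 := rfl

@[simp] theorem denotation_terminal_cons (S : N → Language T) (t : T) :
    denotation S (.terminal t :: α) = {[t]} * denotation S α := by simp [denotation]

@[simp] theorem denotation_nonterminal_cons (S : N → Language T) (X : N) :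
    denotation S (.nonterminal X :: α) = S X * denotation S α := by simp [denotation]

@[simp] theorem denotation_append (S : N → Language T) :
    denotation S (α ++ β) = denotation S α * denotation S β := by simp [denotation]

theorem denotation_map_terminal (S : N → Language T) (w : List T) :
    denotation S (w.map .terminal) = {w} := by
  induction w with
  | nil => rfl
  | cons t w ih =>
    ext x
    simp only [List.map_cons, denotation_terminal_cons, ih, Language.mem_mul]
    exact ⟨fun ⟨_, ha, _, hb, hx⟩ ↦ by cases ha; cases hb; exact hx.symm,
      fun hx ↦ ⟨[t], rfl, w, rfl, Eq.symm hx⟩⟩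

/-- If a family of languages is closed under all rules, then it contains every derived word: the
derived words form the least solution of the system of inclusions described by the rules. -/
theorem mem_denotation {S : N → Language T} (hS : ∀ X β, (X, β) ∈ R → denotation S β ≤ S X)
    (h : Yields R α w) : w ∈ denotation S α := by
  induction h with
  | nil => exact Language.nil_mem_one
  | terminal _ ih =>
    rw [denotation_terminal_cons]
    exact Language.append_mem_mul (a := [_]) (Set.mem_singleton _) ih
  | nonterminal hX _ _ ihu ih =>
    rw [denotation_nonterminal_cons]
    exact Language.append_mem_mul (hS _ _ hX ihu) ih

theorem mem_of_rules_le {S : N → Language T} (hS : ∀ X β, (X, β) ∈ R → denotation S β ≤ S X)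
    {X : N} (h : Yields R [.nonterminal X] w) : w ∈ S X := by
  simpa using mem_denotation hS h

end Yields

/-- Rename the nonterminals of a symbol. -/
def Symbol.mapNT {T N N' : Type*} (e : N → N') : Symbol T N → Symbol T N'
  | .terminal t => .terminal t
  | .nonterminal X => .nonterminal (e X)

theorem Symbol.map_mapNT_map_terminal {T N N' : Type*} (e : N → N') (w : List T) :
    (w.map .terminal).map (Symbol.mapNT e) = w.map .terminal := by
  simp [Function.comp_def, Symbol.mapNT]

/-- Finitely many context-free rules define a context-free language. Mathlib's grammars have their
nonterminals in `Type`; only finitely many nonterminals occur in the rules, so they can be coded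
by natural numbers. -/
theorem Language.isContextFree_of_finite_rules {T N : Type*} {R : Set (N × List (Symbol T N))}
    (hR : R.Finite) (S : N) :
    Language.IsContextFree ({w | Yields R [.nonterminal S] w} : Language T) := by
  classical
  let occ : Set N := {S} ∪ ⋃ r ∈ R, ({r.1} ∪ {Y | Symbol.nonterminal Y ∈ r.2})
  have hocc : occ.Finite := by
    refine (Set.finite_singleton S).union (hR.biUnion fun r _ ↦ (Set.finite_singleton _).union ?_)
    exact Set.Finite.preimage (fun _ _ _ _ h ↦ by simpa using h) (List.finite_toSet r.2)
  obtain ⟨e, he⟩ := Set.countable_iff_exists_injOn.1 hocc.countable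
  have hinput : ∀ {X β}, (X, β) ∈ R → X ∈ occ := fun {X β} h ↦
    Or.inr (Set.mem_biUnion h (Or.inl rfl))
  have houtput : ∀ {X β}, (X, β) ∈ R → ∀ Y, Symbol.nonterminal Y ∈ β → Y ∈ occ :=
    fun {X β} h Y hY ↦ Or.inr (Set.mem_biUnion h (Or.inr hY))
  let f : Symbol T N → Symbol T ℕ := Symbol.mapNT e
  let code : N × List (Symbol T N) → ContextFreeRule T ℕ := fun r ↦ ⟨e r.1, r.2.map f⟩
  let g : ContextFreeGrammar T := ⟨ℕ, e S, (hR.image code).toFinset⟩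
  have hrules : ∀ r, r ∈ g.rules ↔ ∃ X β, (X, β) ∈ R ∧ code (X, β) = r := fun r ↦ by
    simp [g]
  have hterm : ∀ w : List T, (w.map .terminal).map f = w.map .terminal :=
    Symbol.map_mapNT_map_terminal e
  have sound : ∀ {α w}, Yields R α w → g.Derives (α.map f) (w.map .terminal) := by
    intro α w h
    induction h with
    | nil => exact Relation.ReflTransGen.refl
    | terminal _ ih => simpa [f, Symbol.mapNT] using ih.append_left [Symbol.terminal _]
    | @nonterminal X β α u w hX _ _ ihu ih =>
      have h1 : g.Produces ([.nonterminal (e X)] ++ α.map f) (β.map f ++ α.map f) :=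
        ⟨code (X, β), (hrules _).2 ⟨X, β, hX, rfl⟩, by
          simpa [code] using ContextFreeRule.Rewrites.head (r := code (X, β)) (α.map f)⟩
      have h2 := (ihu.append_right (α.map f)).trans (ih.append_left (u.map .terminal))
      simpa [f, Symbol.mapNT] using h1.trans_derives h2
  -- As `e` is injective on `occ`, a rule that applies to a coded form is the code of a rule in `R`
  -- that applies to the form itself.
  have complete : ∀ {γ : List (Symbol T ℕ)} {w : List T}, g.Derives γ (w.map .terminal) →
      ∀ α, (∀ Y, Symbol.nonterminal Y ∈ α → Y ∈ occ) → γ = α.map f → Yields R α w := by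
    intro γ w h
    induction h using Relation.ReflTransGen.head_induction_on with
    | refl =>
      intro α _ h
      suffices α = w.map .terminal from this ▸ Yields.map_terminal R w
      clear * - h
      induction w generalizing α with
      | nil => simpa using h.symm
      | cons t w ih =>
        obtain _ | ⟨s, α⟩ := α
        · simp at h
        · simp only [List.map_cons, List.cons.injEq] at h ⊢
          refine ⟨?_, ih α h.2⟩
          cases s with
          | terminal t' => simpa [f, Symbol.mapNT] using h.1.symm
          | nonterminal X => simp [f, Symbol.mapNT] at h
    | head h _ ih =>
      rintro α hα rfl
      obtain ⟨r, hr, hrw⟩ := h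
      obtain ⟨X, β, hX, rfl⟩ := (hrules r).1 hr
      obtain ⟨p, q, hpq, rfl⟩ := hrw.exists_parts
      rw [List.map_eq_append_iff] at hpq
      obtain ⟨a, b, rfl, ha, rfl⟩ := hpq
      rw [List.map_eq_append_iff] at ha
      obtain ⟨a, s, rfl, rfl, hs⟩ := ha
      obtain ⟨s, rfl, hs⟩ := List.map_eq_singleton_iff.1 hs
      cases s with
      | terminal t => simp [f, Symbol.mapNT] at hs
      | nonterminal Y =>
        have hYX : Y = X := he (hα Y (by simp)) (hinput hX) (by
          simpa [f, Symbol.mapNT, code] using hs)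
        subst hYX
        have := ih (a ++ β ++ b) (fun Z hZ ↦ by
          simp only [List.mem_append] at hZ
          rcases hZ with (hZ | hZ) | hZ
          · exact hα Z (by simp [hZ])
          · exact houtput hX Z hZ
          · exact hα Z (by simp [hZ])) (by simp [code])
        obtain ⟨x, v, rfl, hx, hv⟩ := Yields.append_iff.1 this
        obtain ⟨x, y, rfl, hx, hy⟩ := Yields.append_iff.1 hx
        exact (hx.append (.of_rule hX hy)).append hv
  refine ⟨g, ?_⟩
  ext w
  rw [ContextFreeGrammar.mem_language_iff]
  refine ⟨fun h ↦ complete h [.nonterminal S] (fun Y hY ↦ ?_) (by simp [f, Symbol.mapNT, g]),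
    fun h ↦ by simpa [f, Symbol.mapNT] using sound h⟩
  exact Or.inl (by simpa using hY)

/-- Finite languages are context-free. -/
theorem Language.isContextFree_of_finite {T : Type*} {L : Language T}
    (hL : Set.Finite (L : Set (List T))) : L.IsContextFree := by
  refine (congrArg IsContextFree ?_).mp (Language.isContextFree_of_finite_rules
    (hL.image fun w ↦ ((), (w.map .terminal : List (Symbol T Unit)))) ())
  ext w
  change Yields _ _ w ↔ _
  rw [Yields.singleton_iff]
  constructor
  swap
  · exact fun hw ↦ ⟨_, ⟨w, hw, rfl⟩, Yields.map_terminal _ w⟩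
  · rintro ⟨_, ⟨v, hv, hβ⟩, h⟩
    cases hβ
    rw [Yields.map_terminal_iff] at h
    exact h ▸ hv

/-- **Nested iterated substitution.** A system of context-free rules stays context-free when the
right-hand sides are drawn from context-free languages: finitely many schemes `s` are given, each
allowing the nonterminal `target s` to be replaced by any sentential form in the context-free
language `K s`. -/
theorem Language.isContextFree_of_schemes {T N σ : Type*} [Finite σ] (target : σ → N)
    (K : σ → Language (Symbol T N)) (hK : ∀ s, (K s).IsContextFree) (S : N) :
    Language.IsContextFree
      ({w | Yields {r | ∃ s, target s = r.1 ∧ r.2 ∈ K s} [.nonterminal S] w} : Language T) := by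
  choose g hg using hK
  set R : Set (N × List (Symbol T N)) := {r | ∃ s, target s = r.1 ∧ r.2 ∈ K s}
  -- `ι s` embeds the symbols of the grammar `g s`, whose terminals are the symbols of the system.
  let ι : ∀ s, Symbol (Symbol T N) (g s).NT → Symbol T (N ⊕ Σ s, (g s).NT) := fun s ↦ fun
    | .terminal (.terminal t) => .terminal t
    | .terminal (.nonterminal X) => .nonterminal (.inl X)
    | .nonterminal Y => .nonterminal (.inr ⟨s, Y⟩)
  let R' : Set ((N ⊕ Σ s, (g s).NT) × List (Symbol T (N ⊕ Σ s, (g s).NT))) :=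
    (Set.range fun s ↦ (.inl (target s), [.nonterminal (.inr ⟨s, (g s).initial⟩)])) ∪
      ⋃ s, (fun r : ContextFreeRule (Symbol T N) (g s).NT ↦
        (.inr ⟨s, r.input⟩, r.output.map (ι s))) '' {r | r ∈ (g s).rules}
  have hR' : R'.Finite := (Set.finite_range _).union
    (Set.finite_iUnion fun s ↦ ((g s).rules.finite_toSet).image _)
  -- Derivations in the grammar of a scheme can be simulated by `R'`.
  have hder : ∀ s (γ γ' : List (Symbol (Symbol T N) (g s).NT)) (w : List T), (g s).Derives γ γ' →
      Yields R' (γ'.map (ι s)) w → Yields R' (γ.map (ι s)) w := by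
    intro s γ γ' w h hw
    induction h using Relation.ReflTransGen.head_induction_on with
    | refl => exact hw
    | head h _ ih =>
      obtain ⟨r, hr, hrw⟩ := h
      obtain ⟨p, q, rfl, rfl⟩ := hrw.exists_parts
      simp only [List.map_append] at ih ⊢
      obtain ⟨x, v, rfl, hx, hv⟩ := Yields.append_iff.1 ih
      obtain ⟨x, y, rfl, hx, hy⟩ := Yields.append_iff.1 hx
      exact (hx.append (.of_rule (Or.inr (Set.mem_iUnion.2 ⟨s, r, hr, rfl⟩)) hy)).append hv
  have hto : ∀ {α : List (Symbol T N)} {w : List T}, Yields R α w →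
      Yields R' (α.map (Symbol.mapNT .inl)) w := by
    intro α w h
    induction h with
    | nil => exact .nil
    | terminal _ ih => exact .terminal ih
    | @nonterminal X β α u w hX _ _ ihu ih =>
      obtain ⟨s, rfl, hβ⟩ := hX
      refine .nonterminal (Or.inl ⟨s, rfl⟩) ?_ ih
      rw [← hg s, ContextFreeGrammar.mem_language_iff] at hβ
      refine hder s [.nonterminal (g s).initial] _ u hβ ?_
      convert ihu using 1
      rw [List.map_map]
      refine List.map_congr_left fun x _ ↦ ?_
      cases x <;> rfl
  -- A form over the symbols of the grammar `g s` first derives, in `g s`, a sentential form `β` of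
  -- the system. A nonterminal `X` of the system occurs in it as a terminal of `g s`.
  have hfrom : ∀ {δ : List (Symbol T (N ⊕ Σ s, (g s).NT))} {w : List T}, Yields R' δ w →
      ∀ s γ, δ = γ.map (ι s) →
      ∃ β : List (Symbol T N), (g s).Derives γ (β.map .terminal) ∧ Yields R β w := by
    intro δ w h
    induction h with
    | nil =>
      intro s γ h
      rw [List.nil_eq, List.map_eq_nil_iff] at h
      exact ⟨[], by simp [h, ContextFreeGrammar.Derives.refl], .nil⟩
    | terminal _ ih =>
      intro s γ h
      obtain ⟨c, γ, rfl, hc, rfl⟩ := List.map_eq_cons_iff.1 h.symm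
      obtain ⟨β, hβ, hy⟩ := ih s γ rfl
      rcases c with (t | X) | Y
      · cases hc
        exact ⟨.terminal _ :: β, by simpa using hβ.append_left [.terminal (.terminal _)],
          .terminal hy⟩
      · cases hc
      · cases hc
    | nonterminal hX _ _ ihu ih =>
      intro s γ h
      obtain ⟨c, γ, rfl, hc, rfl⟩ := List.map_eq_cons_iff.1 h.symm
      obtain ⟨β, hβ, hy⟩ := ih s γ rfl
      rcases c with (t | X) | Y
      · cases hc
      · cases hc
        rcases hX with ⟨s', hs'⟩ | hX
        · simp only [Prod.mk.injEq, Sum.inl.injEq] at hs'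
          obtain ⟨hs', hβ'⟩ := hs'
          obtain ⟨β', hd, hy'⟩ := ihu s' [.nonterminal (g s').initial] hβ'.symm
          refine ⟨.nonterminal X :: β, by
            simpa using hβ.append_left [.terminal (.nonterminal X)], ?_⟩
          refine .nonterminal ⟨s', hs', ?_⟩ hy' hy
          rw [← hg s']
          exact hd
        · obtain ⟨s', r, _, hr⟩ := Set.mem_iUnion.1 hX
          simp at hr
      · cases hc
        rcases hX with ⟨s', hs'⟩ | hX
        · simp at hs'
        · obtain ⟨s', r, hr, hr'⟩ := Set.mem_iUnion.1 hX
          simp only [Prod.mk.injEq, Sum.inr.injEq, Sigma.mk.injEq] at hr'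
          obtain ⟨⟨rfl, hY⟩, rfl⟩ := hr'
          cases hY
          obtain ⟨β', hd, hy'⟩ := ihu s' r.output rfl
          refine ⟨β' ++ β, ?_, hy'.append hy⟩
          have h1 : (g s').Produces (.nonterminal r.input :: γ) (r.output ++ γ) := ⟨r, hr, .head _⟩
          have h2 := (hd.append_right γ).trans (hβ.append_left (β'.map .terminal))
          simpa using h1.trans_derives h2
  refine (congrArg IsContextFree ?_).mp (Language.isContextFree_of_finite_rules hR' (.inl S))
  ext w
  refine ⟨fun h ↦ ?_, fun h ↦ hto h⟩
  obtain ⟨β, hX, hβ⟩ := Yields.singleton_iff.1 h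
  rcases hX with ⟨s, hs⟩ | hX
  · simp only [Prod.mk.injEq, Sum.inl.injEq] at hs
    obtain ⟨rfl, rfl⟩ := hs
    obtain ⟨β, hd, hy⟩ := hfrom hβ s [.nonterminal (g s).initial] rfl
    refine Yields.of_rule ⟨s, rfl, ?_⟩ hy
    rw [← hg s]
    exact hd
  · obtain ⟨s', r, _, hr⟩ := Set.mem_iUnion.1 hX
    simp at hr

/-! ### Finite-state transductions -/

/-- The computations of a finite-state transducer with edge set `E`: an edge `(p, t, v, q)` leads
from the state `p` to the state `q`, reads the letter `t` and writes the word `v`.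
`TransducerPath E p x y q` says that some path from `p` to `q` reads `x` and writes `y`. -/
inductive TransducerPath {Q T T' : Type*} (E : Set (Q × T × List T' × Q)) :
    Q → List T → List T' → Q → Prop
  | nil (p : Q) : TransducerPath E p [] [] p
  | cons {p q r : Q} {t : T} {v y : List T'} {x : List T} :
      (p, t, v, q) ∈ E → TransducerPath E q x y r → TransducerPath E p (t :: x) (v ++ y) r

namespace TransducerPath

variable {Q T T' : Type*} {E : Set (Q × T × List T' × Q)} {p q r : Q} {x x' : List T}
  {y y' : List T'}

theorem append (h : TransducerPath E p x y q) (h' : TransducerPath E q x' y' r) :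
    TransducerPath E p (x ++ x') (y ++ y') r := by
  induction h with
  | nil => exact h'
  | cons he _ ih => simpa using cons he (ih h')

end TransducerPath

/-- The sentential forms of the triple construction: the ways to annotate the symbols of `γ` with
the states of a path from `p` to `q`. A nonterminal `X` becomes a triple `(p', X, q')` with states
in `Qs`, and a terminal becomes an edge that reads it. -/
def stateAnnotations {Q T T' N : Type*} (E : Set (Q × T × List T' × Q)) (Qs : Set Q) :
    List (Symbol T N) → Q → Q →
      Set (List (Symbol T' ((Q × N × Q) ⊕ (Q × T × List T' × Q))))
  | [], p, q => {δ | δ = [] ∧ p = q}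
  | .terminal t :: γ, p, q =>
      ⋃ e ∈ {e | e ∈ E ∧ e.1 = p ∧ e.2.1 = t},
        (fun δ ↦ .nonterminal (.inr e) :: δ) '' stateAnnotations E Qs γ e.2.2.2 q
  | .nonterminal X :: γ, p, q =>
      ⋃ r ∈ Qs, (fun δ ↦ .nonterminal (.inl (p, X, r)) :: δ) '' stateAnnotations E Qs γ r q

section

variable {Q T T' N : Type*} {E : Set (Q × T × List T' × Q)} {Qs : Set Q}

theorem stateAnnotations_finite (hE : E.Finite) (hQ : Qs.Finite) (γ : List (Symbol T N)) (p q : Q) :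
    (stateAnnotations E Qs γ p q).Finite := by
  induction γ generalizing p with
  | nil => exact (Set.finite_singleton []).subset fun δ hδ ↦ hδ.1
  | cons s γ ih =>
    cases s with
    | terminal t => exact (hE.subset fun e he ↦ he.1).biUnion fun e _ ↦ (ih _).image _
    | nonterminal X => exact hQ.biUnion fun r _ ↦ (ih _).image _

theorem mem_stateAnnotations_terminal {t : T} {γ : List (Symbol T N)} {p q : Q}
    {δ : List (Symbol T' ((Q × N × Q) ⊕ (Q × T × List T' × Q)))} :
    δ ∈ stateAnnotations E Qs (.terminal t :: γ) p q ↔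
      ∃ v r δ', (p, t, v, r) ∈ E ∧ δ' ∈ stateAnnotations E Qs γ r q ∧
        δ = .nonterminal (.inr (p, t, v, r)) :: δ' := by
  simp only [stateAnnotations, Set.mem_iUnion, Set.mem_image, Set.mem_ofPred_eq, exists_prop]
  constructor
  · rintro ⟨⟨p, t, v, r⟩, ⟨he, rfl, rfl⟩, δ', hδ', rfl⟩
    exact ⟨v, r, δ', he, hδ', rfl⟩
  · rintro ⟨v, r, δ', he, hδ', rfl⟩
    exact ⟨_, ⟨he, rfl, rfl⟩, δ', hδ', rfl⟩

theorem mem_stateAnnotations_nonterminal {X : N} {γ : List (Symbol T N)} {p q : Q}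
    {δ : List (Symbol T' ((Q × N × Q) ⊕ (Q × T × List T' × Q)))} :
    δ ∈ stateAnnotations E Qs (.nonterminal X :: γ) p q ↔
      ∃ r ∈ Qs, ∃ δ' ∈ stateAnnotations E Qs γ r q,
        δ = .nonterminal (.inl (p, X, r)) :: δ' := by
  simp only [stateAnnotations, Set.mem_iUnion, Set.mem_image, exists_prop, eq_comm]

theorem mem_stateAnnotations_append (hE : ∀ e ∈ E, e.2.2.2 ∈ Qs) {γ γ' : List (Symbol T N)}
    {p q : Q} (hp : p ∈ Qs) {δ : List (Symbol T' ((Q × N × Q) ⊕ (Q × T × List T' × Q)))} :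
    δ ∈ stateAnnotations E Qs (γ ++ γ') p q ↔
      ∃ r ∈ Qs, ∃ δ₁ ∈ stateAnnotations E Qs γ p r, ∃ δ₂ ∈ stateAnnotations E Qs γ' r q,
        δ = δ₁ ++ δ₂ := by
  induction γ generalizing p δ with
  | nil =>
    constructor
    · exact fun h ↦ ⟨p, hp, [], ⟨rfl, rfl⟩, δ, h, rfl⟩
    · rintro ⟨r, _, _, ⟨rfl, rfl⟩, δ₂, h, rfl⟩
      exact h
  | cons s γ ih =>
    rw [List.cons_append]
    cases s with
    | terminal t =>
      simp only [mem_stateAnnotations_terminal]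
      constructor
      · rintro ⟨v, r, δ', he, hδ', rfl⟩
        obtain ⟨s, hs, δ₁, h₁, δ₂, h₂, rfl⟩ := (ih (hE _ he)).1 hδ'
        exact ⟨s, hs, _, ⟨v, r, δ₁, he, h₁, rfl⟩, δ₂, h₂, rfl⟩
      · rintro ⟨s, hs, _, ⟨v, r, δ₁, he, h₁, rfl⟩, δ₂, h₂, rfl⟩
        exact ⟨v, r, _, he, (ih (hE _ he)).2 ⟨s, hs, δ₁, h₁, δ₂, h₂, rfl⟩, rfl⟩
    | nonterminal X =>
      simp only [mem_stateAnnotations_nonterminal]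
      constructor
      · rintro ⟨r, hr, δ', hδ', rfl⟩
        obtain ⟨s, hs, δ₁, h₁, δ₂, h₂, rfl⟩ := (ih hr).1 hδ'
        exact ⟨s, hs, _, ⟨r, hr, δ₁, h₁, rfl⟩, δ₂, h₂, rfl⟩
      · rintro ⟨s, hs, _, ⟨r, hr, δ₁, h₁, rfl⟩, δ₂, h₂, rfl⟩
        exact ⟨r, hr, _, (ih hr).2 ⟨s, hs, δ₁, h₁, δ₂, h₂, rfl⟩, rfl⟩

end

/-- The image of a context-free language under a finite-state transduction is context-free, by the
triple construction: the nonterminal `(p, X, q)` derives what the transducer can write on a path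
from `p` to `q` that reads a word derived from `X`. -/
theorem Language.IsContextFree.transduce {Q T T' : Type*} {L : Language T} (hL : L.IsContextFree)
    {E : Set (Q × T × List T' × Q)} (hE : E.Finite) (q₀ q₁ : Q) :
    Language.IsContextFree ({y | ∃ x ∈ L, TransducerPath E q₀ x y q₁} : Language T') := by
  obtain ⟨g, rfl⟩ := hL
  let Qs : Set Q := {q₀, q₁} ∪ (fun e ↦ e.2.2.2) '' E
  have hQ : Qs.Finite := (Set.toFinite _).union (hE.image _)
  have hEQ : ∀ e ∈ E, e.2.2.2 ∈ Qs := fun e he ↦ Or.inr ⟨e, he, rfl⟩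
  let R : Set (((Q × g.NT × Q) ⊕ (Q × T × List T' × Q)) ×
      List (Symbol T' ((Q × g.NT × Q) ⊕ (Q × T × List T' × Q)))) :=
    (⋃ r ∈ {r | r ∈ g.rules}, ⋃ p ∈ Qs, ⋃ q ∈ Qs,
      (fun δ ↦ (.inl (p, r.input, q), δ)) '' stateAnnotations E Qs r.output p q) ∪
    (fun e ↦ (.inr e, e.2.2.1.map .terminal)) '' E
  have hR : R.Finite := Set.Finite.union
    (g.rules.finite_toSet.biUnion fun r _ ↦ hQ.biUnion fun p _ ↦ hQ.biUnion fun q _ ↦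
      (stateAnnotations_finite hE hQ _ p q).image _) (hE.image _)
  have hinl : ∀ {p X q δ}, (.inl (p, X, q), δ) ∈ R ↔ p ∈ Qs ∧ q ∈ Qs ∧
      ∃ β, ⟨X, β⟩ ∈ g.rules ∧ δ ∈ stateAnnotations E Qs β p q := by
    intro p X q δ
    constructor
    · rintro (h | ⟨e, _, he⟩)
      · simp only [Set.mem_iUnion, Set.mem_image] at h
        obtain ⟨r, hr, p, hp, q, hq, δ, hδ, h⟩ := h
        cases h
        exact ⟨hp, hq, r.output, hr, hδ⟩
      · cases he
    · rintro ⟨hp, hq, β, hr, hδ⟩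
      refine Or.inl ?_
      simp only [Set.mem_iUnion, Set.mem_image]
      exact ⟨_, hr, p, hp, q, hq, δ, hδ, rfl⟩
  have hinr : ∀ {e δ}, (.inr e, δ) ∈ R ↔ e ∈ E ∧ δ = e.2.2.1.map .terminal := by
    intro e δ
    constructor
    · rintro (h | ⟨e, he, h⟩)
      · simp only [Set.mem_iUnion, Set.mem_image] at h
        obtain ⟨r, hr, p, hp, q, hq, δ, hδ, h⟩ := h
        cases h
      · cases h
        exact ⟨he, rfl⟩
    · rintro ⟨he, rfl⟩
      exact Or.inr ⟨e, he, rfl⟩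
  have complete : ∀ {γ : List (Symbol T g.NT)} {x : List T}, g.Derives γ (x.map .terminal) →
      ∀ {p y q}, p ∈ Qs → TransducerPath E p x y q →
        ∃ δ ∈ stateAnnotations E Qs γ p q, Yields R δ y := by
    intro γ x h
    induction h using Relation.ReflTransGen.head_induction_on with
    | refl =>
      intro p y q hp h
      clear hp
      induction h with
      | nil p => exact ⟨[], ⟨rfl, rfl⟩, .nil⟩
      | cons he _ ih =>
        obtain ⟨δ, hδ, hy⟩ := ih
        exact ⟨_, mem_stateAnnotations_terminal.2 ⟨_, _, δ, he, hδ, rfl⟩,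
          .nonterminal (hinr.2 ⟨he, rfl⟩) (Yields.map_terminal R _) hy⟩
    | head h _ ih =>
      intro p y q hp hpath
      obtain ⟨δ, hδ, hy⟩ := ih hp hpath
      obtain ⟨r, hr, hrw⟩ := h
      obtain ⟨a, b, rfl, rfl⟩ := hrw.exists_parts
      obtain ⟨q', hq', _, h₁₂, δ₃, h₃, rfl⟩ := (mem_stateAnnotations_append hEQ hp).1 hδ
      obtain ⟨p', hp', δ₁, h₁, δ₂, h₂, rfl⟩ := (mem_stateAnnotations_append hEQ hp).1 h₁₂
      obtain ⟨u, w₃, rfl, hu, hw₃⟩ := Yields.append_iff.1 hy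
      obtain ⟨w₁, w₂, rfl, hw₁, hw₂⟩ := Yields.append_iff.1 hu
      refine ⟨δ₁ ++ [.nonterminal (.inl (p', r.input, q'))] ++ δ₃, ?_,
        (hw₁.append (.of_rule (hinl.2 ⟨hp', hq', r.output, hr, h₂⟩) hw₂)).append hw₃⟩
      refine (mem_stateAnnotations_append hEQ hp).2 ⟨q', hq', _, ?_, δ₃, h₃, rfl⟩
      refine (mem_stateAnnotations_append hEQ hp).2 ⟨p', hp', δ₁, h₁, _, ?_, rfl⟩
      exact mem_stateAnnotations_nonterminal.2 ⟨q', hq', [], ⟨rfl, rfl⟩, rfl⟩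
  have sound : ∀ {δ y}, Yields R δ y → ∀ {γ p q}, δ ∈ stateAnnotations E Qs γ p q →
      ∃ x : List T, g.Derives γ (x.map .terminal) ∧ TransducerPath E p x y q := by
    intro δ y h
    induction h with
    | nil =>
      intro γ p q hδ
      obtain _ | ⟨t | X, γ⟩ := γ
      · obtain ⟨_, rfl⟩ := hδ
        exact ⟨[], Relation.ReflTransGen.refl, .nil p⟩
      · simp [mem_stateAnnotations_terminal] at hδ
      · simp [mem_stateAnnotations_nonterminal] at hδ
    | terminal _ _ =>
      intro γ p q hδ
      obtain _ | ⟨t | X, γ⟩ := γ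
      · simp [stateAnnotations] at hδ
      · simp [mem_stateAnnotations_terminal] at hδ
      · simp [mem_stateAnnotations_nonterminal] at hδ
    | nonterminal hX hu _ ihu ih =>
      intro γ p q hδ
      obtain _ | ⟨t | X, γ⟩ := γ
      · simp [stateAnnotations] at hδ
      · obtain ⟨v, r, δ', he, hδ', h⟩ := mem_stateAnnotations_terminal.1 hδ
        cases h
        obtain ⟨x, hx, hpath⟩ := ih hδ'
        rw [(hinr.1 hX).2, Yields.map_terminal_iff] at hu
        subst hu
        exact ⟨t :: x, by simpa using hx.append_left [.terminal t], .cons he hpath⟩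
      · obtain ⟨r, hr, δ', hδ', h⟩ := mem_stateAnnotations_nonterminal.1 hδ
        cases h
        obtain ⟨x, hx, hpath⟩ := ih hδ'
        obtain ⟨_, _, β, hβ, hδβ⟩ := hinl.1 hX
        obtain ⟨x', hx', hpath'⟩ := ihu hδβ
        refine ⟨x' ++ x, ?_, hpath'.append hpath⟩
        have h1 : g.Produces (.nonterminal X :: γ) (β ++ γ) := ⟨_, hβ, .head _⟩
        have h2 := (hx'.append_right γ).trans (hx.append_left (x'.map .terminal))
        simpa using h1.trans_derives h2
  have h₀ : q₀ ∈ Qs := Or.inl (Or.inl rfl)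
  have h₁ : q₁ ∈ Qs := Or.inl (Or.inr rfl)
  refine (congrArg IsContextFree ?_).mp
    (Language.isContextFree_of_finite_rules hR (.inl (q₀, g.initial, q₁)))
  have hinit : [.nonterminal (.inl (q₀, g.initial, q₁))] ∈
      stateAnnotations E Qs [.nonterminal g.initial] q₀ q₁ :=
    mem_stateAnnotations_nonterminal.2 ⟨q₁, h₁, [], ⟨rfl, rfl⟩, rfl⟩
  ext y
  constructor
  · exact fun h ↦ sound h hinit
  · rintro ⟨x, hx, hpath⟩
    obtain ⟨δ, hδ, hy⟩ := complete hx h₀ hpath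
    obtain ⟨r, _, _, ⟨rfl, rfl⟩, rfl⟩ := mem_stateAnnotations_nonterminal.1 hδ
    exact hy

/-- Context-free languages over a finite alphabet are closed under renaming of letters. -/
theorem Language.IsContextFree.map {T T' : Type*} [Finite T] {L : Language T}
    (hL : L.IsContextFree) (f : T → T') : (Language.map f L).IsContextFree := by
  let E : Set (Unit × T × List T' × Unit) := Set.range fun t ↦ ((), t, [f t], ())
  refine (congrArg IsContextFree ?_).mp (hL.transduce (Set.finite_range _ : E.Finite) () ())
  have hpath : ∀ {p x y q}, TransducerPath E p x y q ↔ x.map f = y := by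
    intro p x y q
    constructor
    · intro h
      induction h with
      | nil => rfl
      | cons he _ ih =>
        obtain ⟨t, ht⟩ := he
        cases ht
        simp [ih]
    · rintro rfl
      induction x with
      | nil => exact .nil _
      | cons t x ih => exact .cons (Set.mem_range_self t) ih
  ext y
  change (∃ x ∈ L, TransducerPath E () x y ()) ↔ ∃ x ∈ L, x.map f = y
  simp only [hpath]

/-- Substitute finite words in the two halves of words `u # v`: letters of `u` are replaced by
means of `f`, letters of `v` by means of `g`, and the separator by `m`. Only those words are kept
whose second half `v` is a word over `B`. -/
theorem Language.IsContextFree.substitute_halves {A T' : Type*} [Finite A]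
    {L : Language (Option A)} (hL : L.IsContextFree) (f : A → List T') (m : List T')
    (g : A → List T') (B : Set A) :
    Language.IsContextFree ({y | ∃ u v : List A, u.map some ++ none :: v.map some ∈ L ∧
      (∀ b ∈ v, b ∈ B) ∧ y = u.flatMap f ++ m ++ v.flatMap g} : Language T') := by
  -- The state records whether the separator has been read.
  let E : Set (Bool × Option A × List T' × Bool) :=
    (Set.range fun a ↦ (false, some a, f a, false)) ∪ {(false, none, m, true)} ∪
      (fun b ↦ (true, some b, g b, true)) '' B
  have hE : E.Finite := ((Set.finite_range _).union (Set.finite_singleton _)).union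
    ((Set.toFinite B).image _)
  refine (congrArg IsContextFree ?_).mp (hL.transduce hE false true)
  have hpath : ∀ {p x y q}, TransducerPath E p x y q → q = true →
      (p = true → ∃ v : List A, x = v.map some ∧ (∀ b ∈ v, b ∈ B) ∧ y = v.flatMap g) ∧
      (p = false → ∃ u v : List A, x = u.map some ++ none :: v.map some ∧
        (∀ b ∈ v, b ∈ B) ∧ y = u.flatMap f ++ m ++ v.flatMap g) := by
    intro p x y q h
    induction h with
    | nil p =>
      rintro rfl
      exact ⟨fun _ ↦ ⟨[], by simp⟩, nofun⟩
    | cons he _ ih =>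
      intro hq
      obtain ⟨ih₁, ih₀⟩ := ih hq
      rcases he with (⟨a, ha⟩ | he) | ⟨b, hb, he⟩
      · cases ha
        obtain ⟨u, v, rfl, hv, rfl⟩ := ih₀ rfl
        exact ⟨nofun, fun _ ↦ ⟨a :: u, v, by simp, hv, by simp⟩⟩
      · cases he
        obtain ⟨v, rfl, hv, rfl⟩ := ih₁ rfl
        exact ⟨nofun, fun _ ↦ ⟨[], v, by simp, hv, by simp⟩⟩
      · cases he
        obtain ⟨v, rfl, hv, rfl⟩ := ih₁ rfl
        exact ⟨fun _ ↦ ⟨b :: v, by simp, by simpa [hb] using hv, by simp⟩, nofun⟩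
  ext y
  constructor
  · rintro ⟨x, hx, h⟩
    obtain ⟨u, v, rfl, hv, rfl⟩ := (hpath h rfl).2 rfl
    exact ⟨u, v, hx, hv, rfl⟩
  · rintro ⟨u, v, hx, hv, rfl⟩
    refine ⟨_, hx, ?_⟩
    have hleft : TransducerPath E false (u.map some) (u.flatMap f) false := by
      clear hx
      induction u with
      | nil => exact .nil _
      | cons a u ih => exact .cons (Or.inl (Or.inl ⟨a, rfl⟩)) ih
    have hright : TransducerPath E true (v.map some) (v.flatMap g) true := by
      clear hx
      induction v with
      | nil => exact .nil _
      | cons b v ih =>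
        simp only [List.mem_cons, forall_eq_or_imp] at hv
        exact .cons (Or.inr ⟨b, hv.1, rfl⟩) (ih hv.2)
    rw [List.append_assoc]
    exact hleft.append (.cons (Or.inl (Or.inr rfl)) hright)

/-! ### Word problems and finitely generated submonoids -/

/-- The element of the monoid represented by a word over a set of elements. -/
def wordProd {M : Type*} [Monoid M] {A : Set M} (w : List A) : M :=
  (w.map Subtype.val).prod

section

variable {M : Type*} [Monoid M] {A : Set M}

@[simp] theorem wordProd_nil : wordProd ([] : List A) = 1 := rfl

@[simp] theorem wordProd_cons (a : A) (w : List A) : wordProd (a :: w) = a * wordProd w := by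
  simp [wordProd]

@[simp] theorem wordProd_append (u v : List A) :
    wordProd (u ++ v) = wordProd u * wordProd v := by
  simp [wordProd]

theorem exists_wordProd_eq (hA : Submonoid.closure A = ⊤) (m : M) :
    ∃ w : List A, wordProd w = m := by
  obtain ⟨l, hl, rfl⟩ := Submonoid.exists_list_of_mem_closure (hA ▸ Submonoid.mem_top m)
  exact ⟨l.attachWith _ hl, by rw [wordProd, List.attachWith_map_subtype_val]⟩

theorem append_separator_inj {α : Type*} {u u' v v' : List α} :
    u.map some ++ none :: v.map some = u'.map some ++ none :: v'.map some ↔ u = u' ∧ v = v' := by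
  refine ⟨fun h ↦ ?_, fun ⟨hu, hv⟩ ↦ by rw [hu, hv]⟩
  have hinj : Function.Injective (List.map (some : α → Option α)) :=
    List.map_injective_iff.2 (Option.some_injective α)
  obtain ⟨hu, -, hv⟩ := (List.append_cons_inj_of_notMem (by simp) (by simp)).1 h
  exact ⟨hinj hu, hinj hv⟩

theorem mem_monoidWordProblem {w : List (Option A)} :
    w ∈ monoidWordProblem A ↔
      ∃ u v : List A, wordProd u = wordProd v ∧ w = u.map some ++ none :: v.reverse.map some :=
  Iff.rfl

theorem append_separator_mem_monoidWordProblem {u v : List A} :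
    u.map some ++ none :: v.map some ∈ monoidWordProblem A ↔
      wordProd u = wordProd v.reverse := by
  rw [mem_monoidWordProblem]
  constructor
  · rintro ⟨u', v', h, heq⟩
    obtain ⟨rfl, rfl⟩ := append_separator_inj.1 heq
    simpa using h
  · exact fun h ↦ ⟨u, v.reverse, h, by simp⟩

end

/-- Context-free languages are closed under inverse images of the maps
`u # v ↦ θ*(u) # θ'*(v)`, where `θ = θ false` and `θ' = θ true` replace letters by nonempty
words. -/
theorem Language.IsContextFree.preimage_halves {C D : Type*} [Finite C] [Finite D]
    {L : Language (Option C)} (hL : L.IsContextFree) (θ : Bool → D → List C)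
    (hθ : ∀ b d, θ b d ≠ []) :
    Language.IsContextFree ({y | ∃ u v : List D, y = u.map some ++ none :: v.map some ∧
      (u.flatMap (θ false)).map some ++ none :: (v.flatMap (θ true)).map some ∈ L} :
        Language (Option D)) := by
  -- A state `(b, s)` records in `b` whether the separator has been read, and in `s` which letters
  -- of the current block `θ b d` are still to be read; `d` is written on entering its block.
  let suffixes : Set (List C) := ⋃ b, ⋃ d, {s | s <:+ θ b d}
  have hsuf : suffixes.Finite := Set.finite_iUnion fun b ↦ Set.finite_iUnion fun d ↦
    (List.finite_toSet (θ b d).tails).subset fun s hs ↦ (List.mem_tails _ _).2 hs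
  let E : Set ((Bool × List C) × Option C × List (Option D) × (Bool × List C)) :=
    ((fun r : (Bool × C) × List C ↦ ((r.1.1, r.1.2 :: r.2), some r.1.2, [], (r.1.1, r.2))) ''
      (Set.univ ×ˢ suffixes)) ∪
    (Set.range fun r : Bool × D ↦
      ((r.1, []), (θ r.1 r.2).head?, [some r.2], (r.1, (θ r.1 r.2).tail))) ∪
    {((false, []), none, [none], (true, []))}
  have hE : E.Finite := ((((Set.toFinite _).prod hsuf).image _).union
    (Set.finite_range _)).union (Set.finite_singleton _)
  refine (congrArg IsContextFree ?_).mp (hL.transduce hE (false, []) (true, []))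
  have hpath : ∀ {p x y q}, TransducerPath E p x y q → q = (true, []) →
      (p.1 = true → ∃ v : List D, x = (p.2 ++ v.flatMap (θ true)).map some ∧ y = v.map some) ∧
      (p.1 = false → ∃ u v : List D,
        x = (p.2 ++ u.flatMap (θ false)).map some ++ none :: (v.flatMap (θ true)).map some ∧
          y = u.map some ++ none :: v.map some) := by
    intro p x y q h
    induction h with
    | nil p =>
      rintro rfl
      exact ⟨fun _ ↦ ⟨[], by simp⟩, nofun⟩
    | cons he _ ih =>
      intro hq
      obtain ⟨ih₁, ih₀⟩ := ih hq
      rcases he with (⟨⟨⟨b, c⟩, s⟩, _, he⟩ | ⟨⟨b, d⟩, he⟩) | he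
      · cases he
        constructor
        · intro hb
          obtain ⟨v, rfl, rfl⟩ := ih₁ hb
          exact ⟨v, by simp⟩
        · intro hb
          obtain ⟨u, v, rfl, rfl⟩ := ih₀ hb
          exact ⟨u, v, by simp⟩
      · obtain ⟨c, s, hcs⟩ := List.exists_cons_of_ne_nil (hθ b d)
        simp only [hcs, List.head?_cons, List.tail_cons] at he
        cases he
        constructor
        · intro hb
          obtain ⟨v, rfl, rfl⟩ := ih₁ hb
          obtain rfl : b = true := hb
          exact ⟨d :: v, by simp [hcs]⟩
        · intro hb
          obtain ⟨u, v, rfl, rfl⟩ := ih₀ hb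
          obtain rfl : b = false := hb
          exact ⟨d :: u, v, by simp [hcs]⟩
      · cases he
        obtain ⟨v, rfl, rfl⟩ := ih₁ rfl
        exact ⟨nofun, fun _ ↦ ⟨[], v, by simp⟩⟩
  have hpending : ∀ b s, s ∈ suffixes → TransducerPath E (b, s) (s.map some) [] (b, []) := by
    intro b s hs
    induction s with
    | nil => exact .nil _
    | cons c s ih =>
      have hs' : s ∈ suffixes := by
        simp only [suffixes, Set.mem_iUnion] at hs ⊢
        obtain ⟨b, d, h⟩ := hs
        exact ⟨b, d, (List.suffix_cons c s).trans h⟩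
      exact .cons (v := []) (Or.inl (Or.inl ⟨((b, c), s), ⟨trivial, hs'⟩, rfl⟩)) (ih hs')
  have hblocks : ∀ b (u : List D),
      TransducerPath E (b, []) ((u.flatMap (θ b)).map some) (u.map some) (b, []) := by
    intro b u
    induction u with
    | nil => exact .nil _
    | cons d u ih =>
      obtain ⟨c, s, hcs⟩ := List.exists_cons_of_ne_nil (hθ b d)
      have hs : s ∈ suffixes := by
        simp only [suffixes, Set.mem_iUnion]
        exact ⟨b, d, hcs ▸ List.suffix_cons c s⟩
      have he : ((b, []), some c, [some d], (b, s)) ∈ E :=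
        Or.inl (Or.inr ⟨(b, d), by simp [hcs]⟩)
      simpa [hcs] using TransducerPath.cons he ((hpending b s hs).append ih)
  ext y
  constructor
  · rintro ⟨x, hx, h⟩
    obtain ⟨u, v, rfl, rfl⟩ := (hpath h rfl).2 rfl
    exact ⟨u, v, rfl, hx⟩
  · rintro ⟨u, v, rfl, hx⟩
    exact ⟨_, hx, (hblocks false u).append (.cons (v := [none]) (Or.inr rfl) (hblocks true v))⟩

theorem HasContextFreeWordProblem.fg {M : Type*} [Monoid M] (h : HasContextFreeWordProblem M) :
    Monoid.FG M := by
  obtain ⟨A, hA, hA', _⟩ := h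
  exact Monoid.fg_iff.2 ⟨A, hA', hA⟩

/-- Finitely generated submonoids of `U(CF)` monoids are `U(CF)`: writing the generators of the
submonoid as words over the generators of the large monoid turns the word problem of the former
into an inverse image of the word problem of the latter. -/
theorem HasContextFreeWordProblem.of_injective {M P : Type*} [Monoid M] [Monoid P]
    (hP : HasContextFreeWordProblem P) (hM : Monoid.FG M) (f : M →* P)
    (hf : Function.Injective f) : HasContextFreeWordProblem M := by
  obtain ⟨C, hC, hCtop, hL⟩ := hP
  obtain ⟨D, hDtop, hD⟩ := Monoid.fg_iff.1 hM
  -- The identity is not needed as a generator, and all other generators are nonempty words.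
  refine ⟨D \ {1}, hD.sdiff, by rw [Submonoid.closure_sdiff_singleton_one, hDtop], ?_⟩
  have := hC.to_subtype
  have : Finite ↥(D \ {1}) := hD.sdiff.to_subtype
  choose θ hθ using fun d : ↥(D \ {1}) ↦ exists_wordProd_eq hCtop (f d)
  have hne : ∀ d, θ d ≠ [] := by
    intro d hd
    refine d.2.2 (hf ?_)
    rw [← hθ d, hd, wordProd_nil, map_one]
  have hprod : ∀ u : List ↥(D \ {1}), wordProd (u.flatMap θ) = f (wordProd u) := by
    intro u
    induction u with
    | nil => simp
    | cons d u ih => simp [ih, hθ]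
  refine (congrArg Language.IsContextFree ?_).mp
    (hL.preimage_halves (fun b d ↦ if b then (θ d).reverse else θ d) fun b d ↦ by
      cases b <;> simp [hne])
  have hrev : ∀ v : List ↥(D \ {1}),
      (v.flatMap fun d ↦ (θ d).reverse).reverse = v.reverse.flatMap θ := by
    intro v
    induction v with
    | nil => rfl
    | cons d v ih => simp [ih]
  have key : ∀ u v : List ↥(D \ {1}),
      (u.flatMap θ).map some ++ none :: (v.flatMap fun d ↦ (θ d).reverse).map some ∈
        monoidWordProblem C ↔ wordProd u = wordProd v.reverse := by
    intro u v
    rw [append_separator_mem_monoidWordProblem, hrev, hprod, hprod, hf.eq_iff]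
  ext y
  constructor
  · rintro ⟨u, v, rfl, h⟩
    exact append_separator_mem_monoidWordProblem.2 ((key u v).1 (by simpa using h))
  · rintro ⟨u, v, h, rfl⟩
    refine ⟨u, v.reverse, rfl, ?_⟩
    have := (key u v.reverse).2 (v.reverse_reverse.symm ▸ h)
    simpa using this

/-! ### Words over the generators of a free product -/

open Monoid (CoprodI)

/-- The generators of the factors, as elements of the free product. -/
def freeProductGenerators {ι : Type*} {G : ι → Type*} [∀ i, Monoid (G i)] (A : ∀ i, Set (G i)) :
    Set (CoprodI G) :=
  ⋃ i, CoprodI.of '' A i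

section

variable {ι : Type*} {G : ι → Type*} [∀ i, Monoid (G i)] {A : ∀ i, Set (G i)}

theorem freeProductGenerators_finite [Finite ι] (hA : ∀ i, (A i).Finite) :
    (freeProductGenerators A).Finite :=
  Set.finite_iUnion fun i ↦ (hA i).image _

theorem closure_freeProductGenerators (hA : ∀ i, Submonoid.closure (A i) = ⊤) :
    Submonoid.closure (freeProductGenerators A) = ⊤ := by
  simp_rw [freeProductGenerators, Submonoid.closure_iUnion, ← MonoidHom.map_mclosure, hA,
    ← MonoidHom.mrange_eq_map, CoprodI.iSup_mrange_of]

/-- A generator of a factor, as a generator of the free product. -/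
def letterOf {i : ι} (a : A i) : freeProductGenerators A :=
  ⟨CoprodI.of (a : G i), Set.mem_iUnion.2 ⟨i, a, a.2, rfl⟩⟩

@[simp] theorem coe_letterOf {i : ι} (a : A i) :
    (letterOf a : CoprodI G) = CoprodI.of (a : G i) := rfl

theorem exists_letterOf_eq (c : freeProductGenerators A) : ∃ (i : ι) (a : A i), letterOf a = c := by
  obtain ⟨c, hc⟩ := c
  obtain ⟨i, a, ha, rfl⟩ := Set.mem_iUnion.1 hc
  exact ⟨i, ⟨a, ha⟩, rfl⟩

/-- `Syllable I i x U` says that `U = a₁ e₁ a₂ e₂ ⋯ aₙ eₙ` for some generators `aⱼ` of the factor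
`G i` with product `x` and some words `eⱼ` in `I`. In the application, `I` consists of words that
represent the identity, so that `U` represents `x`. -/
inductive Syllable (I : Set (List (freeProductGenerators A))) (i : ι) :
    G i → List (freeProductGenerators A) → Prop
  | nil : Syllable I i 1 []
  | cons (a : A i) {e U : List (freeProductGenerators A)} {x : G i} :
      e ∈ I → Syllable I i x U → Syllable I i (a * x) (letterOf a :: (e ++ U))

/-- The concatenations of syllables that spell out a given list of elements of the factors. -/
def syllableWords (I : Set (List (freeProductGenerators A))) :
    List (Σ i, G i) → Set (List (freeProductGenerators A))
  | [] => {[]}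
  | x :: l => {w | ∃ U V, w = U ++ V ∧ Syllable I x.1 x.2 U ∧ V ∈ syllableWords I l}

open scoped Classical in
/-- Every word consists of an identity word followed by syllables that spell out the normal form of
the element represented. Only those identity words are needed that are built up by inserting
identity words after the letters of an identity word over one factor. -/
theorem exists_mem_syllableWords {I : Set (List (freeProductGenerators A))} (hnil : [] ∈ I)
    (hI : ∀ i U, Syllable I i 1 U → U ∈ I) (u : List (freeProductGenerators A)) :
    ∃ e ∈ I, ∃ U ∈ syllableWords I (CoprodI.Word.equiv (wordProd u)).toList, u = e ++ U := by
  induction u with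
  | nil => exact ⟨[], hnil, [], rfl, rfl⟩
  | cons c u ih =>
    obtain ⟨i, a, rfl⟩ := exists_letterOf_eq c
    obtain ⟨e, he, U, hU, rfl⟩ := ih
    set n := CoprodI.Word.equiv (wordProd (e ++ U))
    have hn : CoprodI.Word.equiv (wordProd (letterOf a :: (e ++ U))) =
        CoprodI.Word.rcons { CoprodI.Word.equivPair i n with
          head := (a : G i) * (CoprodI.Word.equivPair i n).head } := by
      rw [← CoprodI.Word.of_smul_def, wordProd_cons]
      exact mul_smul (CoprodI.of (a : G i)) (wordProd (e ++ U))
        (CoprodI.Word.empty (M := G))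
    rw [hn]
    have hp : CoprodI.Word.rcons (CoprodI.Word.equivPair i n) = n :=
      (CoprodI.Word.equivPair i).symm_apply_apply n
    generalize CoprodI.Word.equivPair i n = p at hp ⊢
    clear_value n
    subst hp
    clear hn
    -- Split off the first syllable, which is empty if the normal form does not begin in `G i`.
    obtain ⟨S, V, hS, hV, rfl⟩ : ∃ S V, Syllable I i p.head S ∧
        V ∈ syllableWords I p.tail.toList ∧ U = S ++ V := by
      by_cases h : p.head = 1
      · rw [CoprodI.Word.rcons, dif_pos h] at hU
        exact ⟨[], U, h ▸ .nil, hU, rfl⟩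
      · rw [CoprodI.Word.rcons, dif_neg h] at hU
        obtain ⟨S, V, rfl, hS, hV⟩ := hU
        exact ⟨S, V, hS, hV, rfl⟩
    have hS' := Syllable.cons a he hS
    by_cases h : (a : G i) * p.head = 1
    · rw [CoprodI.Word.rcons, dif_pos h]
      exact ⟨_, hI i _ (h ▸ hS'), V, hV, by simp⟩
    · rw [CoprodI.Word.rcons, dif_neg h]
      exact ⟨[], hnil, _, ⟨_, V, rfl, hS', hV⟩, by simp⟩

theorem Syllable.wordProd_eq {I : Set (List (freeProductGenerators A))}
    (hI : ∀ e ∈ I, wordProd e = 1) {i : ι} {x : G i} {U : List (freeProductGenerators A)}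
    (h : Syllable I i x U) : wordProd U = CoprodI.of x := by
  induction h with
  | nil => simp
  | cons a he _ ih => simp [hI _ he, ih]

variable {T N : Type*} (τ : freeProductGenerators A → T)

/-- The sentential form `a₁ X a₂ X ⋯ aₙ X`. -/
def syllableForm (X : N) {i : ι} (u : List (A i)) : List (Symbol T N) :=
  u.flatMap fun a ↦ [.terminal (τ (letterOf a)), .nonterminal X]

/-- The sentential form `X a₁ X a₂ ⋯ X aₙ`. -/
def reverseSyllableForm (X : N) {i : ι} (u : List (A i)) : List (Symbol T N) :=
  u.flatMap fun a ↦ [.nonterminal X, .terminal (τ (letterOf a))]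

theorem Syllable.exists_yields {I : Set (List (freeProductGenerators A))}
    {R : Set (N × List (Symbol T N))} {X : N}
    (hI : ∀ e ∈ I, Yields R [.nonterminal X] (e.map τ)) {i : ι} {x : G i}
    {U : List (freeProductGenerators A)} (h : Syllable I i x U) :
    ∃ u : List (A i), wordProd u = x ∧ Yields R (syllableForm τ X u) (U.map τ) := by
  induction h with
  | nil => exact ⟨[], rfl, .nil⟩
  | cons a he _ ih =>
    obtain ⟨u, rfl, hu⟩ := ih
    exact ⟨a :: u, by simp, by simpa [syllableForm] using .terminal ((hI _ he).append hu)⟩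

theorem Syllable.exists_yields_reverse {I : Set (List (freeProductGenerators A))}
    {R : Set (N × List (Symbol T N))} {X : N}
    (hI : ∀ e ∈ I, Yields R [.nonterminal X] (e.reverse.map τ)) {i : ι} {x : G i}
    {U : List (freeProductGenerators A)} (h : Syllable I i x U) :
    ∃ u : List (A i), wordProd u.reverse = x ∧
      Yields R (reverseSyllableForm τ X u) (U.reverse.map τ) := by
  induction h with
  | nil => exact ⟨[], rfl, .nil⟩
  | cons a he _ ih =>
    obtain ⟨u, hx, hu⟩ := ih
    have := hu.append ((hI _ he).append (.terminal (t := τ (letterOf a)) .nil))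
    refine ⟨u ++ [a], by simp [hx], by simpa [reverseSyllableForm] using this⟩

theorem exists_of_mem_denotation_syllableForm {S : N → Language T} {X : N}
    (hX : ∀ w ∈ S X, ∃ e : List (freeProductGenerators A), wordProd e = 1 ∧ w = e.map τ) {i : ι}
    (u : List (A i)) {w : List T} (hw : w ∈ Yields.denotation S (syllableForm τ X u)) :
    ∃ U : List (freeProductGenerators A),
      wordProd U = CoprodI.of (wordProd u) ∧ w = U.map τ := by
  induction u generalizing w with
  | nil => exact ⟨[], by simp, hw⟩
  | cons a u ih =>
    rw [syllableForm, List.flatMap_cons, ← syllableForm, List.cons_append, List.cons_append,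
      List.nil_append, Yields.denotation_terminal_cons, Yields.denotation_nonterminal_cons] at hw
    obtain ⟨_, rfl, _, ⟨w₁, h₁, w₂, h₂, rfl⟩, rfl⟩ := hw
    obtain ⟨e, he, rfl⟩ := hX w₁ h₁
    obtain ⟨U, hU, rfl⟩ := ih h₂
    exact ⟨letterOf a :: (e ++ U), by simp [he, hU], by simp⟩

theorem exists_of_mem_denotation_reverseSyllableForm {S : N → Language T} {X : N}
    (hX : ∀ w ∈ S X, ∃ e : List (freeProductGenerators A), wordProd e = 1 ∧ w = e.reverse.map τ)
    {i : ι} (u : List (A i)) {w : List T}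
    (hw : w ∈ Yields.denotation S (reverseSyllableForm τ X u)) :
    ∃ U : List (freeProductGenerators A),
      wordProd U = CoprodI.of (wordProd u.reverse) ∧ w = U.reverse.map τ := by
  induction u generalizing w with
  | nil => exact ⟨[], by simp, hw⟩
  | cons a u ih =>
    rw [reverseSyllableForm, List.flatMap_cons, ← reverseSyllableForm, List.cons_append,
      List.cons_append, List.nil_append, Yields.denotation_nonterminal_cons,
      Yields.denotation_terminal_cons] at hw
    obtain ⟨w₁, h₁, _, ⟨_, rfl, w₂, h₂, rfl⟩, rfl⟩ := hw
    obtain ⟨e, he, rfl⟩ := hX w₁ h₁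
    obtain ⟨U, hU, rfl⟩ := ih h₂
    exact ⟨U ++ letterOf a :: e, by simp [he, hU], by simp⟩

end

/-! ### The word problem of a free product -/

section

variable {ι : Type*} [Finite ι] [Nonempty ι] {G : ι → Type*} [∀ i, Monoid (G i)]
  {A : ∀ i, Set (G i)}

/-- The words that represent the identity of a free product are derived from the rules
`X → a₁ X a₂ X ⋯ aₙ X`, one for each word `a₁ a₂ ⋯ aₙ` that represents the identity of a factor. -/
theorem isContextFree_identityWords (hA : ∀ i, (A i).Finite)
    (h : ∀ i, (monoidWordProblem (A i)).IsContextFree) :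
    Language.IsContextFree
      ({w | wordProd w = 1} : Language (freeProductGenerators A)) := by
  have := fun i ↦ (hA i).to_subtype
  have hcf := Language.isContextFree_of_schemes (fun _ : ι ↦ ()) _
    (fun i ↦ (h i).substitute_halves
      (fun a : A i ↦ [Symbol.terminal (letterOf a : freeProductGenerators A), .nonterminal ()])
      [] (fun _ ↦ []) ∅) ()
  refine (congrArg Language.IsContextFree ?_).mp hcf
  set R : Set (Unit × List (Symbol (freeProductGenerators A) Unit)) := {r | _}
  have hR : ∀ {β}, ((), β) ∈ R ↔ ∃ (i : ι) (u : List (A i)), wordProd u = 1 ∧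
      β = syllableForm id () u := by
    intro β
    constructor
    · rintro ⟨i, -, u, v, huv, hv, rfl⟩
      obtain rfl := List.eq_nil_iff_forall_not_mem.2 hv
      exact ⟨i, u, append_separator_mem_monoidWordProblem.1 huv, by simp [syllableForm]⟩
    · rintro ⟨i, u, hu, rfl⟩
      exact ⟨i, rfl, u, [], append_separator_mem_monoidWordProblem.2 hu, by simp,
        by simp [syllableForm]⟩
  clear_value R
  ext w
  constructor
  · refine Yields.mem_of_rules_le (S := fun _ ↦ {w | wordProd w = 1}) ?_
    intro X β hβ w hw
    obtain ⟨i, u, hu, rfl⟩ := hR.1 hβ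
    obtain ⟨U, hU, rfl⟩ := exists_of_mem_denotation_syllableForm id
      (fun w hw ↦ ⟨w, hw, by simp⟩) u hw
    change wordProd _ = 1
    simp [hU, hu]
  · intro hw
    have hI : ∀ i U, Syllable {w | Yields R [.nonterminal ()] w} i 1 U →
        U ∈ {w | Yields R [.nonterminal ()] w} := by
      intro i U hU
      obtain ⟨u, hu, hy⟩ := hU.exists_yields (R := R) (X := ()) id (fun e he ↦ by simpa using he)
      exact .of_rule (hR.2 ⟨i, u, hu, rfl⟩) (by simpa using hy)
    obtain ⟨i⟩ := ‹Nonempty ι›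
    obtain ⟨e, he, U, hU, rfl⟩ := exists_mem_syllableWords (hI i [] .nil) hI w
    rw [show wordProd (e ++ U) = 1 from hw] at hU
    obtain rfl : U = [] := by
      simpa [CoprodI.Word.equiv, syllableWords] using hU
    rw [List.append_nil]
    exact he

/-- The word problem of a free product is derived from the rules `W → #`, `W → I W I'` and
`W → a₁ I ⋯ aₘ I W I' bₙ ⋯ I' b₁`, one for each pair of words `a₁ ⋯ aₘ` and `b₁ ⋯ bₙ` that represent
the same element of a factor; here `I` derives the identity words and `I'` their reversals. -/
theorem isContextFree_monoidWordProblem_freeProductGenerators (hA : ∀ i, (A i).Finite)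
    (h : ∀ i, (monoidWordProblem (A i)).IsContextFree) :
    (monoidWordProblem (freeProductGenerators A)).IsContextFree := by
  have := fun i ↦ (hA i).to_subtype
  have := (freeProductGenerators_finite hA).to_subtype
  have hone := isContextFree_identityWords hA h
  set One : Language (freeProductGenerators A) := {w | wordProd w = 1}
  -- The nonterminal `W` is `none`, `I` is `some false`, and `I'` is `some true`.
  let K : Option Bool ⊕ ι → Language (Symbol (Option (freeProductGenerators A)) (Option Bool)) :=
    Sum.elim (fun
        | none => {[.terminal none],
            [.nonterminal (some false), .nonterminal none, .nonterminal (some true)]}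
        | some false => One.map fun c ↦ .terminal (some c)
        | some true => One.reverse.map fun c ↦ .terminal (some c))
      fun i ↦ {y | ∃ u v : List (A i), u.map some ++ none :: v.map some ∈ monoidWordProblem (A i) ∧
        (∀ b ∈ v, b ∈ Set.univ) ∧ y = syllableForm some (some false) u ++ [.nonterminal none] ++
          reverseSyllableForm some (some true) v}
  have hK : ∀ s, (K s).IsContextFree := by
    rintro ((_ | _ | _) | i)
    · exact Language.isContextFree_of_finite (Set.toFinite {_, _})
    · exact hone.map _
    · exact hone.reverse.map _
    · exact (h i).substitute_halves _ _ _ _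
  have hcf := Language.isContextFree_of_schemes (Sum.elim id fun _ ↦ none) K hK none
  refine (congrArg Language.IsContextFree ?_).mp hcf
  set R : Set (Option Bool × List (Symbol (Option (freeProductGenerators A)) (Option Bool))) :=
    {r | _}
  have hsep : (none, [.terminal none]) ∈ R := ⟨.inl none, rfl, Or.inl rfl⟩
  have hpad :
      (none, [.nonterminal (some false), .nonterminal none, .nonterminal (some true)]) ∈ R :=
    ⟨.inl none, rfl, Or.inr rfl⟩
  have hfactor : ∀ (i : ι) (u v : List (A i)), wordProd u = wordProd v.reverse →
      (none, syllableForm some (some false) u ++ [.nonterminal none] ++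
        reverseSyllableForm some (some true) v) ∈ R := fun i u v huv ↦
    ⟨.inr i, rfl, u, v, append_separator_mem_monoidWordProblem.2 huv, by simp, rfl⟩
  have hI : ∀ e ∈ One, Yields R [.nonterminal (some false)] (e.map some) := fun e he ↦
    .of_rule ⟨.inl (some false), rfl, e, he, rfl⟩ (by
      simpa [Function.comp_def] using Yields.map_terminal R (e.map some))
  have hI' : ∀ e ∈ One, Yields R [.nonterminal (some true)] (e.reverse.map some) := fun e he ↦
    .of_rule ⟨.inl (some true), rfl, e.reverse, Language.reverse_mem_reverse.2 he, rfl⟩ (by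
      simpa [Function.comp_def] using Yields.map_terminal R (e.reverse.map some))
  ext w
  constructor
  · let S : Option Bool → Language (Option (freeProductGenerators A)) := fun
      | none => monoidWordProblem (freeProductGenerators A)
      | some false => {w | ∃ e : List (freeProductGenerators A), wordProd e = 1 ∧ w = e.map some}
      | some true =>
        {w | ∃ e : List (freeProductGenerators A), wordProd e = 1 ∧ w = e.reverse.map some}
    have hmap : ∀ e : List (freeProductGenerators A),
        e.map (fun c ↦ (.terminal (some c) :
          Symbol (Option (freeProductGenerators A)) (Option Bool))) =
        (e.map some).map .terminal := fun e ↦ by simp [Function.comp_def]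
    refine Yields.mem_of_rules_le (S := S) ?_
    rintro X β ⟨(_ | _ | _) | i, hX, hβ⟩ w hw
    · cases hX
      rcases hβ with hβ | hβ
      · cases hβ
        rw [Yields.denotation_terminal_cons, Yields.denotation_nil, mul_one] at hw
        cases hw
        exact ⟨[], [], rfl, rfl⟩
      · cases hβ
        simp only [Yields.denotation_nonterminal_cons, Yields.denotation_nil, mul_one] at hw
        obtain ⟨_, ⟨e, he, rfl⟩, _, ⟨_, ⟨u, v, huv, rfl⟩, _, ⟨e', he', rfl⟩, rfl⟩, rfl⟩ := hw
        refine ⟨e ++ u, e' ++ v, ?_, by simp⟩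
        change wordProd (e ++ u) = wordProd (e' ++ v)
        rw [wordProd_append, wordProd_append, he, he', one_mul, one_mul]
        exact huv
    · cases hX
      obtain ⟨e, he, rfl⟩ := hβ
      rw [hmap, Yields.denotation_map_terminal] at hw
      exact ⟨e, he, hw⟩
    · cases hX
      obtain ⟨e, he, rfl⟩ := hβ
      rw [hmap, Yields.denotation_map_terminal] at hw
      exact ⟨e.reverse, he, by rw [List.reverse_reverse]; exact hw⟩
    · cases hX
      obtain ⟨u, v, huv, -, rfl⟩ := hβ
      rw [append_separator_mem_monoidWordProblem] at huv
      rw [Yields.denotation_append, Yields.denotation_append, Yields.denotation_nonterminal_cons,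
        Yields.denotation_nil, mul_one] at hw
      obtain ⟨_, ⟨w₁, h₁, _, ⟨u', v', huv', rfl⟩, rfl⟩, w₃, h₃, rfl⟩ := hw
      obtain ⟨U, hU, rfl⟩ := exists_of_mem_denotation_syllableForm some (fun w hw ↦ hw) u h₁
      obtain ⟨V, hV, rfl⟩ := exists_of_mem_denotation_reverseSyllableForm some (fun w hw ↦ hw) v h₃
      refine ⟨U ++ u', V ++ v', ?_, by simp⟩
      change wordProd (U ++ u') = wordProd (V ++ v')
      rw [wordProd_append, wordProd_append, hU, hV, huv]
      exact congrArg _ huv'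
  · rw [mem_monoidWordProblem]
    rintro ⟨u, v, huv, rfl⟩
    have hSyl : ∀ i U, Syllable One i 1 U → U ∈ One := fun i U hU ↦ by
      change wordProd U = 1
      simpa using hU.wordProd_eq (fun _ h ↦ h)
    have hcore : ∀ l : List (Σ i, G i), ∀ U ∈ syllableWords One l, ∀ V ∈ syllableWords One l,
        Yields R [.nonterminal none] (U.map some ++ none :: V.reverse.map some) := by
      intro l
      induction l with
      | nil =>
        rintro _ rfl _ rfl
        exact .of_rule hsep (.terminal .nil)
      | cons x l ih =>
        rintro _ ⟨U₁, U₂, rfl, hU₁, hU₂⟩ _ ⟨V₁, V₂, rfl, hV₁, hV₂⟩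
        obtain ⟨a, ha, hya⟩ := hU₁.exists_yields some hI
        obtain ⟨b, hb, hyb⟩ := hV₁.exists_yields_reverse some hI'
        have := (hya.append (ih U₂ hU₂ V₂ hV₂)).append hyb
        exact .of_rule (hfactor x.1 a b (ha.trans hb.symm)) (by simpa using this)
    have hnil : [] ∈ One := wordProd_nil
    obtain ⟨e, he, U, hU, rfl⟩ := exists_mem_syllableWords hnil hSyl u
    obtain ⟨e', he', V, hV, rfl⟩ := exists_mem_syllableWords hnil hSyl v
    rw [← huv] at hV
    have := ((hI e he).append (hcore _ U hU V hV)).append (hI' e' he')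
    exact .of_rule hpad (by simpa using this)

/-- The free product of a nonempty finite family of `U(CF)` monoids is `U(CF)`. -/
theorem HasContextFreeWordProblem.coprodI (h : ∀ i, HasContextFreeWordProblem (G i)) :
    HasContextFreeWordProblem (CoprodI G) := by
  choose A hA hAtop hAcf using h
  exact ⟨freeProductGenerators A, freeProductGenerators_finite hA,
    closure_freeProductGenerators hAtop,
    isContextFree_monoidWordProblem_freeProductGenerators hA hAcf⟩

end

/-- Over a family indexed by `Bool`, the binary free product embeds into the indexed one. -/
theorem exists_injective_coprod_coprodI {M N : Type*} [Monoid M] [Monoid N] {G : Bool → Type*}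
    [∀ b, Monoid (G b)] (eM : M ≃* G true) (eN : N ≃* G false) :
    ∃ f : Monoid.Coprod M N →* CoprodI G, Function.Injective f := by
  let f : Monoid.Coprod M N →* CoprodI G := Monoid.Coprod.lift
    (CoprodI.of.comp eM.toMonoidHom) (CoprodI.of.comp eN.toMonoidHom)
  let g : CoprodI G →* Monoid.Coprod M N := CoprodI.lift fun
    | true => Monoid.Coprod.inl.comp eM.symm.toMonoidHom
    | false => Monoid.Coprod.inr.comp eN.symm.toMonoidHom
  have hgf : g.comp f = MonoidHom.id _ := by
    refine Monoid.Coprod.hom_ext ?_ ?_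
    · ext m
      simp [f, g]
    · ext n
      simp [f, g]
  exact ⟨f, Function.LeftInverse.injective (g := g) fun x ↦ DFunLike.congr_fun hgf x⟩

theorem HasContextFreeWordProblem.of_mulEquiv {M P : Type*} [Monoid M] [Monoid P]
    (hP : HasContextFreeWordProblem P) (e : M ≃* P) : HasContextFreeWordProblem M := by
  have := hP.fg
  exact hP.of_injective (Monoid.fg_of_surjective e.symm.toMonoidHom e.symm.surjective)
    e.toMonoidHom e.injective

/-- The free product of two `U(CF)` monoids is `U(CF)`. It embeds into the free product of a family
indexed by `Bool`, whose members have to be lifted to a common universe. -/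
theorem HasContextFreeWordProblem.coprod {M : Type u} {N : Type v} [Monoid M] [Monoid N]
    (hM : HasContextFreeWordProblem M) (hN : HasContextFreeWordProblem N) :
    HasContextFreeWordProblem (Monoid.Coprod M N) := by
  obtain ⟨G, _, ⟨eM⟩, ⟨eN⟩⟩ : ∃ (G : Bool → Type (max u v)) (_ : ∀ b, Monoid (G b)),
      Nonempty (M ≃* G true) ∧ Nonempty (N ≃* G false) :=
    ⟨Bool.rec (ULift.{u} N) (ULift.{v} M), Bool.rec ULift.monoid ULift.monoid,
      ⟨(MulEquiv.ulift : ULift.{v} M ≃* M).symm⟩, ⟨(MulEquiv.ulift : ULift.{u} N ≃* N).symm⟩⟩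
  have hfgM := hM.fg
  have hfgN := hN.fg
  have hG : ∀ b, HasContextFreeWordProblem (G b) :=
    Bool.rec (hN.of_mulEquiv eN.symm) (hM.of_mulEquiv eM.symm)
  have hfg : Monoid.FG (Monoid.Coprod M N) := by
    rw [Monoid.fg_def, ← Monoid.Coprod.mrange_inl_sup_mrange_inr]
    refine Submonoid.FG.sup ?_ ?_
    · rw [MonoidHom.mrange_eq_map]
      exact (Monoid.fg_def.1 hfgM).map _
    · rw [MonoidHom.mrange_eq_map]
      exact (Monoid.fg_def.1 hfgN).map _
  obtain ⟨f, hf⟩ := exists_injective_coprod_coprodI eM eN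
  exact (HasContextFreeWordProblem.coprodI hG).of_injective hfg f hf

/-- Free factors of `U(CF)` monoids are `U(CF)`: they are finitely generated, being retracts. -/
theorem HasContextFreeWordProblem.of_isMonoidFreeFactor {M : Type u} {P : Type v} [Monoid M]
    [Monoid P] (hM : IsMonoidFreeFactor.{u, v, w} M P) (hP : HasContextFreeWordProblem P) :
    HasContextFreeWordProblem M := by
  obtain ⟨N, _, ⟨e⟩⟩ := hM
  have := hP.fg
  have hfg : Monoid.FG M := Monoid.fg_of_surjective (Monoid.Coprod.fst.comp e.toMonoidHom)
    (Monoid.Coprod.fst_surjective.comp e.surjective)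
  exact hP.of_injective hfg (e.symm.toMonoidHom.comp Monoid.Coprod.inl)
    (e.symm.injective.comp Monoid.Coprod.inl_injective)

theorem mainTheorem4 :
    (∀ (M : Type u) (N : Type v) [Monoid M] [Monoid N],
      HasContextFreeWordProblem M → HasContextFreeWordProblem N →
        HasContextFreeWordProblem (Monoid.Coprod M N)) ∧
    (∀ (M : Type u) (P : Type v) [Monoid M] [Monoid P],
      IsMonoidFreeFactor.{u, v, w} M P → HasContextFreeWordProblem P →
        HasContextFreeWordProblem M) :=
  ⟨fun _ _ _ _ hM hN ↦ hM.coprod hN, fun _ _ _ _ hM hP ↦ .of_isMonoidFreeFactor hM hP⟩
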